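/- Let $n\ge 0$, and let $(W,S)$ be a Coxeter system with $S=\{s_1,\dots,s_n\}$ of type $\mathrm{A}_n$ or $\mathrm{B}_n$, with the generators numbered along the Coxeter diagram: $s_is_j$ has order $2$ for $|i-j|\ge 2$ and order $3$ for $|i-j|=1$, except that in type $\mathrm{B}_n$ ($n\ge 2$) the product $s_1s_2$ has order $4$. (For $n=1$ both types are $\langle s_1\mid s_1^2\rangle$; for $n=0$ the group is trivial.) *Deletion order.* For $0\le i\le n$ define a strict total order $<_\Delta^i$ on the words in $s_1,\dots,s_i$ recursively. For $i=0$ there is only the empty word. For $i\ge 1$, cut a word $u$ at the occurrences of $s_i$, $u=b_0s_ib_1s_i\cdots s_ib_k$ with $b_0,\dots,b_k$ (possibly empty) words in $s_1,\dots,s_{i-1}$, and likewise $v=c_0s_ic_1s_i\cdots s_ic_\ell$. Then $u<_\Delta^i v$ if $k<\ell$, or if $k=\ell$, $u\neq v$, and $b_j<_\Delta^{i-1}c_j$ for the least $j$ with $b_j\ne c_j$. Put ${<_\Delta}={<_\Delta^n}$. For $w\in W$ let $\mathrm{NF}_\Delta(w)$ be the $<_\Delta$-least reduced word for $w$, and for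 $u,v\in W$ write $u<_\Delta^W v$ if $\mathrm{NF}_\Delta(u)<_\Delta\mathrm{NF}_\Delta(v)$. Let $L(w)=|\{u\in W : u<_\Delta^W w\}|+1$ be the position of $w$ in this order. Then $W$ is finite, it has a unique element $\omega_0$ of maximal length, and $$L(w)+L(\omega_0w)=|W|+1\qquad\text{for every } w\in W.$$ -/

import Mathlib

namespace DeletionOrder

/-- The Coxeter matrix of type `B_n` whose vertices are numbered so that the double edge
(the label `4`) joins the first two vertices. Mathlib's `CoxeterMatrix.B n` puts the double edge
at the other end of the diagram, so the numbering of the vertices is reversed. -/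
def typeB (n : ℕ) : CoxeterMatrix (Fin n) := (CoxeterMatrix.B n).reindex Fin.revPerm

variable {n : ℕ}

/-- The deletion sequence `[b₀, …, b_ℓ]` of the word `w` with respect to the letter `j`: the word
is cut at every occurrence of `j`, so that `w = b₀ j b₁ j … j b_ℓ` and `j` occurs in no `bᵢ`.
It is `[w]` if `j` does not occur in `w`. -/
def deletionSeq (j : ℕ) (w : List (Fin n)) : List (List (Fin n)) :=
  w.splitOnP fun a => decide ((a : ℕ) = j)

/-- The deletion order on the words in the first `i` letters `0, …, i - 1`. Two such words are
compared through their deletion sequences with respect to the largest letter `i - 1`: the word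
with the shorter deletion sequence is the smaller one; if both sequences have the same length, then
their first distinct entries are compared in the deletion order on words in `i - 1` letters.
On no letters there is only the empty word; on one letter this compares the lengths. -/
def levelLT : ℕ → List (Fin n) → List (Fin n) → Prop
  | 0, _, _ => False
  | i + 1, u, v => List.Shortlex (levelLT i) (deletionSeq i u) (deletionSeq i v)

/-- The deletion order `u <_Δ v` on all words over the alphabet `Fin n`. -/
def wordLT (u v : List (Fin n)) : Prop := levelLT n u v

section Facts

theorem levelLT_wf (i : ℕ) : WellFounded (levelLT (n := n) i) := by
  induction i with
  | zero => exact ⟨fun a => ⟨a, fun _ h => h.elim⟩⟩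
  | succ i ih => exact InvImage.wf (deletionSeq i) (List.Shortlex.wf ih)

theorem deletionSeq_injective (j : ℕ) :
    Function.Injective (deletionSeq (n := n) j) := by
  intro u
  induction u with
  | nil =>
    intro v h
    cases v with
    | nil => rfl
    | cons y v =>
      simp only [deletionSeq, List.splitOnP_nil, List.splitOnP_cons_eq_if_modifyHead] at h
      have h2 := List.splitOnP_ne_nil (fun a : Fin n => decide ((a : ℕ) = j)) v
      cases h3 : List.splitOnP (fun a : Fin n => decide ((a : ℕ) = j)) v with
      | nil => exact absurd h3 h2
      | cons b t => rw [h3] at h; split_ifs at h <;> simp at h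
  | cons x u ih =>
    intro v h
    have hu := List.splitOnP_ne_nil (fun a : Fin n => decide ((a : ℕ) = j)) u
    cases h3 : List.splitOnP (fun a : Fin n => decide ((a : ℕ) = j)) u with
    | nil => exact absurd h3 hu
    | cons b t =>
      cases v with
      | nil =>
        simp only [deletionSeq, List.splitOnP_nil, List.splitOnP_cons_eq_if_modifyHead, h3] at h
        split_ifs at h <;> simp at h
      | cons y v =>
        have hv := List.splitOnP_ne_nil (fun a : Fin n => decide ((a : ℕ) = j)) v
        cases h4 : List.splitOnP (fun a : Fin n => decide ((a : ℕ) = j)) v with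
        | nil => exact absurd h4 hv
        | cons c s =>
          have key : b :: t = c :: s → u = v := fun e => ih (by
            simp only [deletionSeq, h3, h4, e])
          simp only [deletionSeq, List.splitOnP_cons_eq_if_modifyHead, h3, h4] at h
          split_ifs at h with hx hy hy
          · simp only [decide_eq_true_eq] at hx hy
            rw [Fin.ext (hx.trans hy.symm), key (List.cons.inj h).2]
          · simp at h
          · simp at h
          · simp only [List.modifyHead_cons, List.cons.injEq] at h
            rw [h.1.1, key (by rw [h.1.2, h.2])]

theorem mem_deletionSeq (j : ℕ) (w : List (Fin n)) :
    ∀ b ∈ deletionSeq j w, ∀ a ∈ b, a ∈ w ∧ (a : ℕ) ≠ j := by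
  induction w with
  | nil => intro b hb a ha; simp [deletionSeq] at hb; simp [hb] at ha
  | cons x w ih =>
    intro b hb a ha
    have hw := List.splitOnP_ne_nil (fun a : Fin n => decide ((a : ℕ) = j)) w
    simp only [deletionSeq] at ih
    cases h3 : List.splitOnP (fun a : Fin n => decide ((a : ℕ) = j)) w with
    | nil => exact absurd h3 hw
    | cons c t =>
      rw [h3] at ih
      simp only [deletionSeq, List.splitOnP_cons_eq_if_modifyHead, h3] at hb
      split_ifs at hb with hx
      · rcases List.mem_cons.1 hb with rfl | hb
        · simp at ha
        · have := ih b hb a ha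
          exact ⟨List.mem_cons_of_mem _ this.1, this.2⟩
      · simp only [decide_eq_true_eq] at hx
        simp only [List.modifyHead_cons, List.mem_cons] at hb
        rcases hb with rfl | hb
        · rcases List.mem_cons.1 ha with rfl | ha
          · exact ⟨List.mem_cons_self, hx⟩
          · have := ih c List.mem_cons_self a ha
            exact ⟨List.mem_cons_of_mem _ this.1, this.2⟩
        · have := ih b (List.mem_cons_of_mem _ hb) a ha
          exact ⟨List.mem_cons_of_mem _ this.1, this.2⟩

theorem lex_total_on {α : Type*} {r : α → α → Prop} {p : α → Prop}
    (h : ∀ a b, p a → p b → r a b ∨ a = b ∨ r b a) :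
    ∀ s t : List α, (∀ a ∈ s, p a) → (∀ a ∈ t, p a) →
      List.Lex r s t ∨ s = t ∨ List.Lex r t s
  | [], [], _, _ => Or.inr (Or.inl rfl)
  | [], _ :: _, _, _ => Or.inl List.Lex.nil
  | _ :: _, [], _, _ => Or.inr (Or.inr List.Lex.nil)
  | a :: s, b :: t, hs, ht => by
    rcases h a b (hs a List.mem_cons_self) (ht b List.mem_cons_self) with hab | rfl | hab
    · exact Or.inl (List.Lex.rel hab)
    · rcases lex_total_on h s t (fun c hc => hs c (List.mem_cons_of_mem _ hc))
        (fun c hc => ht c (List.mem_cons_of_mem _ hc)) with h1 | rfl | h1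
      · exact Or.inl (List.Lex.cons h1)
      · exact Or.inr (Or.inl rfl)
      · exact Or.inr (Or.inr (List.Lex.cons h1))
    · exact Or.inr (Or.inr (List.Lex.rel hab))

theorem levelLT_total (i : ℕ) (u v : List (Fin n)) (hu : ∀ a ∈ u, (a : ℕ) < i)
    (hv : ∀ a ∈ v, (a : ℕ) < i) : levelLT i u v ∨ u = v ∨ levelLT i v u := by
  induction i generalizing u v with
  | zero =>
    have e : ∀ w : List (Fin n), (∀ a ∈ w, (a : ℕ) < 0) → w = [] := fun w hw =>
      List.eq_nil_iff_forall_not_mem.2 fun a ha => absurd (hw a ha) (Nat.not_lt_zero _)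
    exact Or.inr (Or.inl ((e u hu).trans (e v hv).symm))
  | succ i ih =>
    have hp : ∀ w : List (Fin n), (∀ a ∈ w, (a : ℕ) < i + 1) →
        ∀ b ∈ deletionSeq i w, ∀ a ∈ b, (a : ℕ) < i := fun w hw b hb a ha => by
      have h := mem_deletionSeq i w b hb a ha
      have := hw a h.1
      omega
    simp only [levelLT, List.shortlex_def]
    rcases lt_trichotomy (deletionSeq i u).length (deletionSeq i v).length with h | h | h
    · exact Or.inl (Or.inl h)
    · rcases lex_total_on (p := fun b : List (Fin n) => ∀ a ∈ b, (a : ℕ) < i)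
        (fun a b ha hb => ih a b ha hb) (deletionSeq i u) (deletionSeq i v) (hp u hu) (hp v hv)
        with h1 | h1 | h1
      · exact Or.inl (Or.inr ⟨h, h1⟩)
      · exact Or.inr (Or.inl (deletionSeq_injective i h1))
      · exact Or.inr (Or.inr (Or.inr ⟨h.symm, h1⟩))
    · exact Or.inr (Or.inr (Or.inl h))

theorem wordLT_wf : WellFounded (wordLT (n := n)) := levelLT_wf n

theorem wordLT_total (u v : List (Fin n)) : wordLT u v ∨ u = v ∨ wordLT v u :=
  levelLT_total n u v (fun a _ => a.isLt) (fun a _ => a.isLt)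

end Facts

section Coxeter

variable {M : CoxeterMatrix (Fin n)} {W : Type*} [Group W] (cs : CoxeterSystem M W)

/-- The set `R(w)` of reduced words for `w`. -/
def reducedWords (w : W) : Set (List (Fin n)) :=
  {u | cs.IsReduced u ∧ cs.wordProd u = w}

/-- Every group element has a unique reduced word that precedes all its other reduced words
in the deletion order. -/
theorem existsUnique_least_reducedWord (w : W) :
    ∃! u, u ∈ reducedWords cs w ∧ ∀ v ∈ reducedWords cs w, v ≠ u → wordLT u v := by
  obtain ⟨u₀, h₀, e₀⟩ := cs.exists_isReduced w
  have hne : (reducedWords cs w).Nonempty := ⟨u₀, h₀, e₀.symm⟩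
  refine ⟨wordLT_wf.min _ hne, ⟨wordLT_wf.min_mem _ hne, fun v hv hvu => ?_⟩, ?_⟩
  · rcases wordLT_total (wordLT_wf.min _ hne) v with h | h | h
    · exact h
    · exact absurd h.symm hvu
    · exact absurd h (wordLT_wf.not_lt_min _ hv)
  · rintro v ⟨hv, hmin⟩
    by_contra hne'
    exact wordLT_wf.not_lt_min _ hv (hmin _ (wordLT_wf.min_mem _ hne) (Ne.symm hne'))

/-- The normal form `NF_Δ(w)`: the least reduced word for `w` in the deletion order. -/
noncomputable def normalForm (w : W) : List (Fin n) :=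
  (existsUnique_least_reducedWord cs w).choose

/-- The deletion order on the group: `u` precedes `v` if the normal form of `u` precedes that
of `v`. -/
def groupLT (u v : W) : Prop := wordLT (normalForm cs u) (normalForm cs v)

/-- The labelling given by the deletion order: `L(w) = |{u ∈ W | u < w}| + 1`. -/
noncomputable def label (w : W) : ℕ := {u : W | groupLT cs u w}.ncard + 1

/-- `ω` is an element of maximal length. -/
def IsLongest (ω : W) : Prop := ∀ w : W, cs.length w ≤ cs.length ω

end Coxeter

end DeletionOrder

/-!
The minimal representatives of the cosets of the parabolic subgroup `W_i`, generated by the first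
`i` reflections, in `W_{i+1}` form a chain `c_0, …, c_t` with exactly one element of each length.
The normal forms of `W_{i+1}` are the words for `c_k` followed by the normal forms of `W_i`, and the
deletion order compares them lexicographically, first by `k` and then by the rest. If `ω_i` is the
longest element of `W_i`, then `ω_{i+1} c_k = c_{t-k} ω_i`. By induction, left multiplication by
`ω₀` therefore reverses the deletion order, so it carries the elements above `w` to the elements
below `ω₀ w`.
-/

namespace DeletionOrder

section StrictTotalOrder

variable {α : Type*} [Finite α] {r : α → α → Prop} [Std.Asymm r] [Std.Trichotomous r]

theorem ncard_add_ncard_of_reversing (e : Equiv.Perm α) (he : ∀ a b, r a b → r (e b) (e a))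
    (a : α) : {b | r b a}.ncard + {b | r b (e a)}.ncard + 1 = Nat.card α := by
  have hiff (b : α) : r (e b) (e a) ↔ r a b := by
    refine ⟨fun h => ?_, he a b⟩
    rcases trichotomous_of r a b with hab | rfl | hba
    · exact hab
    · exact (irrefl_of r _ h).elim
    · exact (asymm_of r h (he b a hba)).elim
  have himage : e '' {b | r a b} = {b | r b (e a)} := by
    ext b
    obtain ⟨c, rfl⟩ := e.surjective b
    exact e.injective.mem_set_image.trans (hiff c).symm
  have hcompl : insert a {b | r a b} = {b | r b a}ᶜ := by
    ext b
    rcases trichotomous_of r a b with h | rfl | h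
    · simp [h, asymm_of r h]
    · simp [irrefl_of r a]
    · have : b ≠ a := by rintro rfl; exact irrefl_of r b h
      simp [h, asymm_of r h, this]
  rw [← himage, Set.ncard_image_of_injective _ e.injective, add_assoc,
    ← Set.ncard_insert_of_notMem (a := a) (s := {b | r a b}) (irrefl_of r a), hcompl,
    Set.ncard_add_ncard_compl]

end StrictTotalOrder

section Shortlex

variable {α : Type*} {r : α → α → Prop}

theorem shortlex_trans [IsTrans α r] {s t u : List α} (hst : List.Shortlex r s t)
    (htu : List.Shortlex r t u) : List.Shortlex r s u := by
  rw [List.shortlex_def] at *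
  rcases hst with h | ⟨h, h'⟩ <;> rcases htu with k | ⟨k, k'⟩
  · exact Or.inl (h.trans k)
  · exact Or.inl (k ▸ h)
  · exact Or.inl (h ▸ k)
  · exact Or.inr ⟨h.trans k, List.lex_trans (trans_of r) h' k'⟩

theorem shortlex_cons_of_rel {a b : α} {s t : List α} (h : s.length = t.length) (hab : r a b) :
    List.Shortlex r (a :: s) (b :: t) :=
  List.Shortlex.of_lex (by simp [h]) (List.Lex.rel hab)

end Shortlex

section Words

variable {n i : ℕ} {u v : List (Fin n)}

instance : IsWellFounded (List (Fin n)) (levelLT i) := ⟨levelLT_wf i⟩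

instance : IsTrans (List (Fin n)) (levelLT i) where
  trans u v w huv hvw := by
    induction i generalizing u v w with
    | zero => exact huv.elim
    | succ i ih =>
      have : IsTrans (List (Fin n)) (levelLT i) := ⟨ih⟩
      exact shortlex_trans (r := levelLT i) huv hvw

/-- The reflexive closure of the deletion order on the words in the first `i` letters. -/
abbrev levelLE (i : ℕ) : List (Fin n) → List (Fin n) → Prop := Relation.ReflGen (levelLT i)

theorem levelLE_succ_of_shortlex
    (h : Relation.ReflGen (List.Shortlex (levelLT i)) (deletionSeq i u) (deletionSeq i v)) :
    levelLE (i + 1) u v := by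
  rcases Relation.reflGen_iff .. |>.1 h with h | h
  · rw [deletionSeq_injective i h]
  · exact .single h

theorem reflGen_shortlex_cons {s t : List (List (Fin n))}
    (hlen : s.length = t.length) (huv : levelLE i u v)
    (hst : u = v → Relation.ReflGen (List.Shortlex (levelLT i)) s t) :
    Relation.ReflGen (List.Shortlex (levelLT i)) (u :: s) (v :: t) := by
  cases huv with
  | refl =>
    cases hst rfl with
    | refl => rfl
    | single h => exact .single h.cons
  | single h => exact .single (shortlex_cons_of_rel hlen h)

/-- The word consisting of the letter with number `i`; it is empty if there is no such letter. -/
def letter (n i : ℕ) : List (Fin n) := if hi : i < n then [⟨i, hi⟩] else []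

theorem letter_of_lt (hi : i < n) : letter n i = [⟨i, hi⟩] := dif_pos hi

theorem val_eq_of_mem_letter {a : Fin n} (ha : a ∈ letter n i) : (a : ℕ) = i := by
  unfold letter at ha
  split_ifs at ha <;> simp_all

theorem deletionSeq_eq_splitOn (hi : i < n) (u : List (Fin n)) :
    deletionSeq i u = u.splitOn ⟨i, hi⟩ := by
  simp only [deletionSeq, List.splitOn_eq_splitOnP, beq_eq_decide, Fin.ext_iff]

theorem intercalate_deletionSeq (hi : i < n) (u : List (Fin n)) :
    (letter n i).intercalate (deletionSeq i u) = u := by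
  rw [deletionSeq_eq_splitOn hi, letter_of_lt hi, List.intercalate_splitOn]

theorem deletionSeq_intercalate (hi : i < n) {bs : List (List (Fin n))}
    (hbs : ∀ b ∈ bs, ∀ a ∈ b, (a : ℕ) < i) (hne : bs ≠ []) :
    deletionSeq i ((letter n i).intercalate bs) = bs := by
  rw [deletionSeq_eq_splitOn hi, letter_of_lt hi]
  exact List.splitOn_intercalate _ (fun b hb ha => (hbs b hb _ ha).false) hne

theorem forall_lt_of_mem_deletionSeq (hu : ∀ a ∈ u, (a : ℕ) < i + 1) :
    ∀ b ∈ deletionSeq i u, ∀ a ∈ b, (a : ℕ) < i := fun b hb a ha =>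
  have h := mem_deletionSeq i u b hb a ha
  lt_of_le_of_ne (Nat.le_of_lt_succ (hu a h.1)) h.2

theorem not_levelLT_nil (i : ℕ) (u : List (Fin n)) : ¬ levelLT i u [] := by
  induction i generalizing u with
  | zero => exact id
  | succ i ih =>
    intro h
    obtain ⟨b, bs, hb⟩ := List.exists_cons_of_ne_nil (List.splitOnP_ne_nil _ u)
    rw [levelLT, deletionSeq, deletionSeq, List.splitOnP_nil, hb] at h
    cases bs with
    | nil => exact ih b ((List.shortlex_singleton_iff _ _).1 h)
    | cons => simp [List.shortlex_def] at h

theorem levelLE_nil (hu : ∀ a ∈ u, (a : ℕ) < i) : levelLE i [] u := by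
  rcases levelLT_total i [] u (by simp) hu with h | rfl | h
  · exact .single h
  · rfl
  · exact (not_levelLT_nil i u h).elim

end Words

section Chains

/-- `top i` is the length of the longest of the minimal representatives of the cosets of the
parabolic subgroup on `i - 1` letters in the one on `i` letters; these representatives have the
lengths `0, …, top i`. -/
structure IsChainLength (top : ℕ → ℕ) : Prop where
  zero : top 0 = 0
  succ : ∀ i, top (i + 1) = top i + 1 ∨ top (i + 1) = top i + 2

/-- The normal form of the minimal coset representative of length `k` on `i` letters. -/
def chainWord (n : ℕ) (top : ℕ → ℕ) : ℕ → ℕ → List (Fin n)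
  | 0, _ => []
  | _ + 1, 0 => []
  | i + 1, k + 1 =>
    if k ≤ top i then chainWord n top i k ++ letter n i
    else letter n i ++ chainWord n top i (top i) ++ letter n i

/-- All but the last (empty) block of the deletion sequence of `chainWord n top (i + 1) k` with
respect to the letter `i`. -/
def chainBlocks (n : ℕ) (top : ℕ → ℕ) (i : ℕ) : ℕ → List (List (Fin n))
  | 0 => []
  | k + 1 => if k ≤ top i then [chainWord n top i k] else [[], chainWord n top i (top i)]

/-- The words obtained by concatenating one chain word for each number of letters from `i` down to
`1`. They turn out to be the normal forms of the elements of the parabolic subgroup on `i`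
letters. -/
inductive IsNormal {n : ℕ} (top : ℕ → ℕ) : ℕ → List (Fin n) → Prop
  | nil : IsNormal top 0 []
  | append {i k : ℕ} {v : List (Fin n)} (hk : k ≤ top (i + 1)) (hv : IsNormal top i v) :
      IsNormal top (i + 1) (chainWord n top (i + 1) k ++ v)

/-- The normal word on `i` letters all of whose chain words are as long as possible. -/
def longestWord (n : ℕ) (top : ℕ → ℕ) : ℕ → List (Fin n)
  | 0 => []
  | i + 1 => chainWord n top (i + 1) (top (i + 1)) ++ longestWord n top i

variable {n : ℕ} {top : ℕ → ℕ} {i k l : ℕ} {u v : List (Fin n)}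

@[simp] theorem chainWord_zero_right (i : ℕ) : chainWord n top i 0 = [] := by
  cases i <;> rfl

theorem chainWord_succ (hk : k ≤ top i) :
    chainWord n top (i + 1) (k + 1) = chainWord n top i k ++ letter n i := if_pos hk

theorem chainWord_succ_of_lt (hk : top i < k) : chainWord n top (i + 1) (k + 1) =
    letter n i ++ chainWord n top i (top i) ++ letter n i := if_neg hk.not_ge

theorem chainBlocks_succ (hk : k ≤ top i) :
    chainBlocks n top i (k + 1) = [chainWord n top i k] := if_pos hk

theorem chainBlocks_succ_of_lt (hk : top i < k) :
    chainBlocks n top i (k + 1) = [[], chainWord n top i (top i)] := if_neg hk.not_ge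

theorem lt_of_mem_chainWord : ∀ a ∈ chainWord n top i k, (a : ℕ) < i := by
  induction i generalizing k with
  | zero => simp [chainWord]
  | succ i ih =>
    intro a ha
    cases k with
    | zero => simp at ha
    | succ k =>
      have key : a ∈ letter n i ∨ ∃ k, a ∈ chainWord n top i k := by
        rw [chainWord] at ha
        split_ifs at ha <;> simp only [List.mem_append] at ha <;> grind
      rcases key with ha | ⟨k, ha⟩
      · exact (val_eq_of_mem_letter ha).trans_lt (Nat.lt_succ_self i)
      · exact (ih a ha).trans (Nat.lt_succ_self i)

theorem lt_of_mem_chainBlocks : ∀ b ∈ chainBlocks n top i k, ∀ a ∈ b, (a : ℕ) < i := by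
  cases k with
  | zero => simp [chainBlocks]
  | succ k =>
    rw [chainBlocks]
    split_ifs <;> simpa using lt_of_mem_chainWord

theorem length_chainWord (ht : IsChainLength top) (hi : i ≤ n) (hk : k ≤ top i) :
    (chainWord n top i k).length = k := by
  induction i generalizing k with
  | zero => simp_all [chainWord, ht.zero]
  | succ i ih =>
    have hin : i ≤ n := Nat.le_of_succ_le hi
    rcases k with _ | k
    · simp
    · rcases le_or_gt k (top i) with h | h
      · simp [chainWord_succ h, ih hin h, letter_of_lt hi]
      · have := ht.succ i
        simp only [chainWord_succ_of_lt h, letter_of_lt hi, List.length_append, ih hin le_rfl,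
          List.length_singleton]
        omega

theorem deletionSeq_chainWord_append (hi : i < n) (hv : ∀ a ∈ v, (a : ℕ) < i) :
    deletionSeq i (chainWord n top (i + 1) k ++ v) = chainBlocks n top i k ++ [v] := by
  have hword : chainWord n top (i + 1) k ++ v =
      (letter n i).intercalate (chainBlocks n top i k ++ [v]) := by
    rcases k with _ | k
    · simp [chainBlocks]
    · rcases le_or_gt k (top i) with h | h
      · simp [chainWord_succ h, chainBlocks_succ h]
      · simp [chainWord_succ_of_lt h, chainBlocks_succ_of_lt h]
  rw [hword, deletionSeq_intercalate hi _ (by simp)]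
  intro b hb
  rcases List.mem_append.1 hb with hb | hb
  · exact lt_of_mem_chainBlocks b hb
  · rwa [List.mem_singleton.1 hb]

theorem levelLT_chainWord_append_of_lt (ht : IsChainLength top) (hi : i < n)
    (hl : l ≤ top (i + 1)) (hkl : k < l) (hu : ∀ a ∈ u, (a : ℕ) < i) (hv : ∀ a ∈ v, (a : ℕ) < i) :
    levelLT (i + 1) (chainWord n top (i + 1) k ++ u) (chainWord n top (i + 1) l ++ v) := by
  induction i using Nat.strong_induction_on generalizing k l u v with | _ i ih
  rw [levelLT, deletionSeq_chainWord_append hi hu, deletionSeq_chainWord_append hi hv]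
  obtain ⟨l, rfl⟩ := Nat.exists_eq_add_one_of_ne_zero (Nat.ne_zero_of_lt hkl)
  rcases k with _ | k
  · refine List.Shortlex.of_length_lt ?_
    rw [chainBlocks, chainBlocks]
    split_ifs <;> simp
  have hki : k ≤ top i := by have := ht.succ i; omega
  rw [chainBlocks_succ hki]
  rcases le_or_gt l (top i) with hli | hli
  · rw [chainBlocks_succ hli]
    refine shortlex_cons_of_rel rfl ?_
    obtain ⟨j, rfl⟩ : ∃ j, i = j + 1 :=
      Nat.exists_eq_add_one_of_ne_zero (by rintro rfl; have := ht.zero; omega)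
    simpa using ih j (Nat.lt_succ_self j) (Nat.lt_of_succ_lt hi) hli
      (Nat.lt_of_succ_lt_succ hkl) (u := []) (v := []) (by simp) (by simp)
  · rw [chainBlocks_succ_of_lt hli]
    exact List.Shortlex.of_length_lt (by simp)

theorem levelLT_append_of_levelLT (hi : i < n) (hu : ∀ a ∈ u, (a : ℕ) < i)
    (hv : ∀ a ∈ v, (a : ℕ) < i) (huv : levelLT i u v) :
    levelLT (i + 1) (chainWord n top (i + 1) k ++ u) (chainWord n top (i + 1) k ++ v) := by
  rw [levelLT, deletionSeq_chainWord_append hi hu, deletionSeq_chainWord_append hi hv]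
  exact ((List.shortlex_singleton_iff u v).2 huv).append_left _

theorem levelLT_chainWord_append_iff (ht : IsChainLength top) (hi : i < n) (hk : k ≤ top (i + 1))
    (hl : l ≤ top (i + 1)) (hu : ∀ a ∈ u, (a : ℕ) < i) (hv : ∀ a ∈ v, (a : ℕ) < i) :
    levelLT (i + 1) (chainWord n top (i + 1) k ++ u) (chainWord n top (i + 1) l ++ v) ↔
      k < l ∨ k = l ∧ levelLT i u v := by
  constructor
  · intro h
    rcases lt_trichotomy k l with hkl | rfl | hlk
    · exact .inl hkl
    · rcases levelLT_total i u v hu hv with huv | rfl | hvu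
      · exact .inr ⟨rfl, huv⟩
      · exact (irrefl_of (levelLT (i + 1)) _ h).elim
      · exact (asymm_of (levelLT (i + 1)) h (levelLT_append_of_levelLT hi hv hu hvu)).elim
    · exact (asymm_of (levelLT (i + 1)) h
        (levelLT_chainWord_append_of_lt ht hi hk hlk hv hu)).elim
  · rintro (hkl | ⟨rfl, huv⟩)
    · exact levelLT_chainWord_append_of_lt ht hi hl hkl hu hv
    · exact levelLT_append_of_levelLT hi hu hv huv

theorem IsNormal.lt_of_mem (hu : IsNormal top i u) : ∀ a ∈ u, (a : ℕ) < i := by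
  induction hu with
  | nil => simp
  | append _ _ ih =>
    intro a ha
    rcases List.mem_append.1 ha with ha | ha
    · exact lt_of_mem_chainWord a ha
    · exact (ih a ha).trans (Nat.lt_succ_self _)

theorem isNormal_nil (i : ℕ) : IsNormal top i ([] : List (Fin n)) := by
  induction i with
  | zero => exact .nil
  | succ i ih => simpa using IsNormal.append (Nat.zero_le (top (i + 1))) ih

theorem isNormal_longestWord (i : ℕ) : IsNormal top i (longestWord n top i) := by
  induction i with
  | zero => exact .nil
  | succ i ih => exact .append le_rfl ih

theorem IsNormal.exists_eq_chainWord_append (hu : IsNormal top i u)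
    (hi : i ≤ n) : ∃ k ≤ top i, levelLE i (chainWord n top i k) u ∧
      ∃ v : List (Fin n), (∀ a ∈ v, (a : ℕ) < i - 1) ∧ u = chainWord n top i k ++ v := by
  rcases hu with _ | @⟨i, k, v, hk, hv⟩
  · exact ⟨0, Nat.zero_le _, .refl, [], by simp, by simp⟩
  · refine ⟨k, hk, ?_, v, hv.lt_of_mem, rfl⟩
    cases levelLE_nil hv.lt_of_mem with
    | refl => simpa using Relation.ReflGen.refl
    | single h =>
      simpa using Relation.ReflGen.single
        (levelLT_append_of_levelLT (top := top) (k := k) hi (by simp) hv.lt_of_mem h)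

theorem IsNormal.length_lt_of_ne (hu : IsNormal top i u) (ht : IsChainLength top) (hi : i ≤ n)
    (hne : u ≠ longestWord n top i) : u.length < (longestWord n top i).length := by
  induction hu with
  | nil => exact (hne rfl).elim
  | @append i k v hk _ ih =>
    have ih := ih (Nat.le_of_succ_le hi)
    rw [longestWord, List.length_append, List.length_append, length_chainWord ht hi hk,
      length_chainWord ht hi le_rfl]
    by_cases hvl : v = longestWord n top i
    · have : k ≠ top (i + 1) := by rintro rfl; exact hne (by rw [hvl, longestWord])
      have := congrArg List.length hvl
      omega
    · have := ih hvl
      omega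

end Chains

section NormalForm

variable {n : ℕ} {M : CoxeterMatrix (Fin n)} {W : Type*} [Group W] (cs : CoxeterSystem M W)

theorem normalForm_mem_reducedWords (w : W) : normalForm cs w ∈ reducedWords cs w :=
  (existsUnique_least_reducedWord cs w).choose_spec.1.1

@[simp] theorem wordProd_normalForm (w : W) : cs.wordProd (normalForm cs w) = w :=
  (normalForm_mem_reducedWords cs w).2

theorem normalForm_eq_of_least {w : W} {u : List (Fin n)} (hu : u ∈ reducedWords cs w)
    (hle : ∀ v ∈ reducedWords cs w, v ≠ u → wordLT u v) : normalForm cs w = u :=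
  (existsUnique_least_reducedWord cs w).unique
    (existsUnique_least_reducedWord cs w).choose_spec.1 ⟨hu, hle⟩

theorem normalForm_injective : Function.Injective (normalForm cs) :=
  Function.LeftInverse.injective (wordProd_normalForm cs)

instance : IsWellFounded W (groupLT cs) := ⟨InvImage.wf _ wordLT_wf⟩

instance : Std.Trichotomous (groupLT cs) where
  trichotomous _ _ huv hvu := normalForm_injective cs
    (((wordLT_total _ _).resolve_left huv).resolve_right hvu)

theorem finite_of_isLongest {ω : W} (hω : IsLongest cs ω) : Finite W := by
  have hfin : {u : List (Fin n) | u.length ≤ cs.length ω}.Finite := List.finite_length_le _ _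
  refine Set.finite_univ_iff.1 (.of_injOn (f := normalForm cs) (fun w _ => ?_)
    (normalForm_injective cs).injOn hfin)
  obtain ⟨hred, hw⟩ := normalForm_mem_reducedWords cs w
  have := hω w
  rwa [← hw, hred.eq] at this

end NormalForm

section CosetChains

variable {n : ℕ} {M : CoxeterMatrix (Fin n)} {W : Type*} [Group W]
  (cs : CoxeterSystem M W) (top : ℕ → ℕ)

/-- The generator with number `i`, or `1` if there is no such generator. -/
def gen (i : ℕ) : W := cs.wordProd (letter n i)

/-- The standard parabolic subgroup generated by the first `i` generators. -/
def parabolic (i : ℕ) : Subgroup W := Subgroup.closure (gen cs '' Set.Iio i)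

/-- The minimal coset representative of length `k` on `i` letters. -/
def chainRep (i k : ℕ) : W := cs.wordProd (chainWord n top i k)

/-- The longest element of the parabolic subgroup on `i` letters. -/
def longest (i : ℕ) : W := cs.wordProd (longestWord n top i)

/-- Left multiplication by the generator `j` either sends the `k`-th coset representative on `i`
letters to one whose index is at most `k + 1`, or it amounts to right multiplication by a generator
of the smaller parabolic subgroup. -/
def IsStep (i j k : ℕ) : Prop :=
  (∃ k' ≤ top i, k' ≤ k + 1 ∧ gen cs j * chainRep cs top i k = chainRep cs top i k') ∨
    ∃ j' < i - 1, gen cs j * chainRep cs top i k = chainRep cs top i k * gen cs j'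

/-- The chain words represent the cosets of each standard parabolic subgroup in the next one,
each coset once, and the longest elements reverse the chains of cosets. -/
structure IsCosetChain : Prop extends IsChainLength top where
  comm : ∀ {i j : ℕ}, j + 1 < i → Commute (gen cs j) (gen cs i)
  step : ∀ {i j k : ℕ}, i < n → j ≤ i → k ≤ top (i + 1) → IsStep cs top (i + 1) j k
  sep : ∀ {i k l : ℕ} {x y : W}, i < n → k ≤ top (i + 1) → l ≤ top (i + 1) →
    x ∈ parabolic cs i → y ∈ parabolic cs i →
    chainRep cs top (i + 1) k * x = chainRep cs top (i + 1) l * y → k = l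
  reversal : ∀ {i k : ℕ}, i < n → k ≤ top (i + 1) →
    longest cs top (i + 1) * chainRep cs top (i + 1) k =
      chainRep cs top (i + 1) (top (i + 1) - k) * longest cs top i

theorem gen_of_lt {i : ℕ} (hi : i < n) : gen cs i = cs.simple ⟨i, hi⟩ := by
  simp [gen, letter_of_lt hi]

theorem gen_of_le {i : ℕ} (hi : n ≤ i) : gen cs i = 1 := by
  simp [gen, letter, hi.not_gt]

@[simp] theorem gen_val (a : Fin n) : gen cs a = cs.simple a := gen_of_lt cs a.isLt

@[simp] theorem gen_mul_self (i : ℕ) : gen cs i * gen cs i = 1 := by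
  rcases lt_or_ge i n with hi | hi
  · rw [gen_of_lt cs hi, cs.simple_mul_simple_self]
  · rw [gen_of_le cs hi, one_mul]

theorem gen_mul_self_assoc (i : ℕ) (w : W) : gen cs i * (gen cs i * w) = w := by
  rw [← mul_assoc, gen_mul_self, one_mul]

variable {cs top} {i j k l : ℕ} {u v : List (Fin n)}

theorem gen_mem_parabolic (hj : j < i) : gen cs j ∈ parabolic cs i :=
  Subgroup.subset_closure ⟨j, hj, rfl⟩

theorem wordProd_mem_parabolic (hu : ∀ a ∈ u, (a : ℕ) < i) : cs.wordProd u ∈ parabolic cs i := by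
  refine Subgroup.list_prod_mem _ fun x hx => ?_
  obtain ⟨a, ha, rfl⟩ := List.mem_map.1 hx
  exact gen_val cs a ▸ gen_mem_parabolic (hu a ha)

theorem commute_of_mem_parabolic {x w : W} (hx : x ∈ parabolic cs i)
    (hw : ∀ j < i, Commute (gen cs j) w) : Commute x w := by
  have hle : parabolic cs i ≤ Subgroup.centralizer {w} := by
    rw [parabolic, Subgroup.closure_le]
    rintro _ ⟨j, hj, rfl⟩
    exact Subgroup.mem_centralizer_singleton_iff.2 (hw j hj).eq
  exact Subgroup.mem_centralizer_singleton_iff.1 (hle hx)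

theorem chainRep_mem_parabolic : chainRep cs top i k ∈ parabolic cs i :=
  wordProd_mem_parabolic lt_of_mem_chainWord

theorem longest_mem_parabolic : longest cs top i ∈ parabolic cs i :=
  wordProd_mem_parabolic (isNormal_longestWord i).lt_of_mem

@[simp] theorem chainRep_zero_right (i : ℕ) : chainRep cs top i 0 = 1 := by simp [chainRep]

theorem chainRep_succ (hk : k ≤ top i) :
    chainRep cs top (i + 1) (k + 1) = chainRep cs top i k * gen cs i := by
  simp [chainRep, chainWord_succ hk, cs.wordProd_append, gen]

theorem chainRep_succ_of_lt (hk : top i < k) :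
    chainRep cs top (i + 1) (k + 1) = gen cs i * chainRep cs top i (top i) * gen cs i := by
  simp [chainRep, chainWord_succ_of_lt hk, cs.wordProd_append, gen, mul_assoc]

theorem longest_succ (i : ℕ) :
    longest cs top (i + 1) = chainRep cs top (i + 1) (top (i + 1)) * longest cs top i :=
  cs.wordProd_append _ _

theorem longest_eq (i : ℕ) :
    longest cs top i = chainRep cs top i (top i) * longest cs top (i - 1) := by
  cases i with
  | zero => simp [chainRep, chainWord]
  | succ i => exact longest_succ i

namespace IsCosetChain

theorem exists_isNormal_gen_mul (h : IsCosetChain cs top) (hi : i ≤ n) (hj : j < i)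
    (hu : IsNormal top i u) : ∃ v, IsNormal top i v ∧ cs.wordProd v = gen cs j * cs.wordProd u ∧
      v.length ≤ u.length + 1 := by
  induction hu generalizing j with
  | nil => exact (Nat.not_lt_zero _ hj).elim
  | @append i k p hk hp ih =>
    have hlen {k} (hk : k ≤ top (i + 1)) := length_chainWord h.toIsChainLength hi hk
    rcases h.step hi (Nat.le_of_lt_succ hj) hk with ⟨k', hk', hkk', e⟩ | ⟨j', hj', e⟩
    · refine ⟨_, .append hk' hp, ?_, ?_⟩
      · simp only [cs.wordProd_append, ← mul_assoc]
        exact congrArg (· * _) e.symm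
      · simp only [List.length_append, hlen hk, hlen hk']
        omega
    · obtain ⟨q, hq, e', hpq⟩ := ih (Nat.le_of_succ_le hi) hj'
      refine ⟨_, .append hk hq, ?_, ?_⟩
      · rw [cs.wordProd_append, cs.wordProd_append, e', ← mul_assoc, ← mul_assoc]
        exact congrArg (· * _) e.symm
      · simp only [List.length_append]
        omega

theorem exists_isNormal (h : IsCosetChain cs top) (hi : i ≤ n) (hu : ∀ a ∈ u, (a : ℕ) < i) :
    ∃ v, IsNormal top i v ∧ cs.wordProd v = cs.wordProd u ∧ v.length ≤ u.length := by
  induction u with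
  | nil => exact ⟨[], isNormal_nil i, rfl, le_rfl⟩
  | cons a u ih =>
    obtain ⟨v, hv, e, hlen⟩ := ih fun b hb => hu b (List.mem_cons_of_mem a hb)
    obtain ⟨w, hw, e', hlen'⟩ := h.exists_isNormal_gen_mul hi (hu a List.mem_cons_self) hv
    refine ⟨w, hw, ?_, hlen'.trans (Nat.succ_le_succ hlen)⟩
    rw [e', e, gen_val, cs.wordProd_cons]

end IsCosetChain

/-- Every normal word on `i` letters is the least of all words on `i` letters that represent the
same element. -/
def NormalWordsLeast (cs : CoxeterSystem M W) (top : ℕ → ℕ) (i : ℕ) : Prop :=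
  ∀ ⦃u v : List (Fin n)⦄, IsNormal top i u → (∀ a ∈ v, (a : ℕ) < i) →
    cs.wordProd u = cs.wordProd v → levelLE i u v

namespace IsCosetChain

/- The letters `a < i - 1` of the normal word for `v` commute with `i`, so they can be moved past
it; what remains on the left is the chain word of a coset representative. -/
theorem reflGen_shortlex_pair (h : IsCosetChain cs top) (hleast : NormalWordsLeast cs top i)
    (hi : i < n) {p v w : List (Fin n)} (hp : IsNormal top i p) (hv : ∀ a ∈ v, (a : ℕ) < i)
    (hw : ∀ a ∈ w, (a : ℕ) < i) (hk : k ≤ top (i + 1))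
    (e : chainRep cs top (i + 1) k * cs.wordProd p =
      cs.wordProd v * gen cs i * cs.wordProd w) :
    ∃ l ≤ top i, k = l + 1 ∧
      Relation.ReflGen (List.Shortlex (levelLT i)) [chainWord n top i l, p] [v, w] := by
  obtain ⟨v', hv', ev, -⟩ := h.exists_isNormal hi.le hv
  obtain ⟨l, hl, hle, y, hy, rfl⟩ := hv'.exists_eq_chainWord_append hi.le
  have hlv : levelLE i (chainWord n top i l) v := _root_.trans hle (hleast hv' hv ev)
  have hcomm : Commute (cs.wordProd y) (gen cs i) :=
    commute_of_mem_parabolic (wordProd_mem_parabolic hy) fun j hj => h.comm (by omega)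
  have hy' : cs.wordProd y ∈ parabolic cs i :=
    wordProd_mem_parabolic fun a ha => (hy a ha).trans_le (Nat.sub_le i 1)
  have hcoset : cs.wordProd v * gen cs i * cs.wordProd w =
      chainRep cs top (i + 1) (l + 1) * (cs.wordProd y * cs.wordProd w) := by
    rw [← ev, cs.wordProd_append, chainRep_succ hl, mul_assoc (cs.wordProd _), hcomm.eq, chainRep]
    simp only [mul_assoc]
  have hl' : l + 1 ≤ top (i + 1) := by have := h.succ i; omega
  obtain rfl : k = l + 1 := h.sep hi hk hl' (wordProd_mem_parabolic hp.lt_of_mem)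
    (mul_mem hy' (wordProd_mem_parabolic hw)) (e.trans hcoset)
  refine ⟨l, hl, rfl, reflGen_shortlex_cons rfl hlv fun hvl => ?_⟩
  refine reflGen_shortlex_cons rfl (hleast hp hw ?_) fun _ => .refl
  rw [chainRep_succ hl, ← hvl] at e
  exact mul_left_cancel e

theorem reflGen_shortlex_triple (h : IsCosetChain cs top) (hleast : NormalWordsLeast cs top i)
    (hi : i < n) {p b v w : List (Fin n)} (hp : IsNormal top i p) (hb : ∀ a ∈ b, (a : ℕ) < i)
    (hv : ∀ a ∈ v, (a : ℕ) < i) (hw : ∀ a ∈ w, (a : ℕ) < i) (hk : top i < k)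
    (e : chainRep cs top (i + 1) (k + 1) * cs.wordProd p =
      cs.wordProd b * gen cs i * cs.wordProd v * gen cs i * cs.wordProd w) :
    Relation.ReflGen (List.Shortlex (levelLT i)) [[], chainWord n top i (top i), p] [b, v, w] := by
  refine reflGen_shortlex_cons rfl (levelLE_nil hb) ?_
  rintro rfl
  have htop : top i + 1 ≤ top (i + 1) := by have := h.succ i; omega
  have e' : chainRep cs top (i + 1) (top i + 1) * cs.wordProd p =
      cs.wordProd v * gen cs i * cs.wordProd w := by
    rw [chainRep_succ_of_lt hk, cs.wordProd_nil, one_mul] at e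
    rw [chainRep_succ le_rfl]
    simpa only [mul_assoc, mul_right_inj] using e
  obtain ⟨l, -, hl, hle⟩ := h.reflGen_shortlex_pair hleast hi hp hv hw htop e'
  obtain rfl : top i = l := Nat.succ_injective hl
  exact hle

theorem reflGen_shortlex_chainBlocks (h : IsCosetChain cs top) (hleast : NormalWordsLeast cs top i)
    (hi : i < n) {p : List (Fin n)} (hp : IsNormal top i p) (hk : k ≤ top (i + 1))
    {bs : List (List (Fin n))} (hbs : ∀ b ∈ bs, ∀ a ∈ b, (a : ℕ) < i) (hne : bs ≠ [])
    (e : chainRep cs top (i + 1) k * cs.wordProd p =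
      cs.wordProd ((letter n i).intercalate bs)) :
    Relation.ReflGen (List.Shortlex (levelLT i)) (chainBlocks n top i k ++ [p]) bs := by
  match bs with
  | [b] =>
    simp only [List.mem_singleton, forall_eq] at hbs
    rw [List.intercalate_singleton] at e
    obtain rfl : k = 0 := h.sep hi hk (Nat.zero_le _) (wordProd_mem_parabolic hp.lt_of_mem)
      (wordProd_mem_parabolic hbs) (by rw [e, chainRep_zero_right, one_mul])
    exact reflGen_shortlex_cons rfl (hleast hp hbs (by simpa using e)) fun _ => .refl
  | [b, c] =>
    simp only [List.forall_mem_cons] at hbs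
    obtain ⟨l, hl, rfl, hle⟩ := h.reflGen_shortlex_pair hleast hi hp hbs.1 hbs.2.1 hk
      (by simpa [cs.wordProd_append, gen, mul_assoc] using e)
    rwa [chainBlocks_succ hl]
  | [b, c, d] =>
    simp only [List.forall_mem_cons] at hbs
    rcases le_or_gt k (top i + 1) with hki | hki
    · refine .single (.of_length_lt ?_)
      rcases k with _ | k
      · simp [chainBlocks]
      · simp [chainBlocks_succ (Nat.le_of_succ_le_succ hki)]
    · obtain ⟨k, rfl⟩ := Nat.exists_eq_add_one_of_ne_zero (Nat.ne_zero_of_lt hki)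
      rw [chainBlocks_succ_of_lt (Nat.lt_of_succ_lt_succ hki)]
      exact h.reflGen_shortlex_triple hleast hi hp hbs.1 hbs.2.1 hbs.2.2.1
        (Nat.lt_of_succ_lt_succ hki) (by simpa [cs.wordProd_append, gen, mul_assoc] using e)
  | _ :: _ :: _ :: _ :: _ =>
    refine .single (.of_length_lt ?_)
    rcases k with _ | k
    · simp [chainBlocks]
    · rw [chainBlocks]
      split_ifs <;> simp

theorem normalWordsLeast (h : IsCosetChain cs top) (hi : i ≤ n) : NormalWordsLeast cs top i := by
  induction i with
  | zero =>
    intro u v hu hv _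
    have hnil {w : List (Fin n)} (hw : ∀ a ∈ w, (a : ℕ) < 0) : w = [] :=
      List.eq_nil_iff_forall_not_mem.2 fun a ha => Nat.not_lt_zero _ (hw a ha)
    rw [hnil hu.lt_of_mem, hnil hv]
  | succ i ih =>
    rintro _ v (_ | @⟨_, k, p, hk, hp⟩) hv e
    refine levelLE_succ_of_shortlex ?_
    rw [deletionSeq_chainWord_append hi hp.lt_of_mem]
    refine h.reflGen_shortlex_chainBlocks (ih (Nat.le_of_succ_le hi)) hi hp hk
      (forall_lt_of_mem_deletionSeq hv) (List.splitOnP_ne_nil _ _) ?_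
    rw [intercalate_deletionSeq hi, ← e, cs.wordProd_append, chainRep]

theorem eq_of_wordProd_eq (h : IsCosetChain cs top) (hi : i ≤ n) (hu : IsNormal top i u)
    (hv : IsNormal top i v) (e : cs.wordProd u = cs.wordProd v) : u = v := by
  rcases h.normalWordsLeast hi hu hv.lt_of_mem e with _ | huv
  · rfl
  rcases h.normalWordsLeast hi hv hu.lt_of_mem e.symm with _ | hvu
  · rfl
  exact (asymm_of (levelLT i) huv hvu).elim

theorem isReduced_of_isNormal (h : IsCosetChain cs top) (hu : IsNormal top n u) :
    cs.IsReduced u := by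
  refine (cs.length_wordProd_le u).antisymm ?_
  obtain ⟨v, hv, e⟩ := cs.exists_isReduced (cs.wordProd u)
  obtain ⟨u', hu', e', hlen⟩ := h.exists_isNormal le_rfl (u := v) fun a _ => a.isLt
  obtain rfl := h.eq_of_wordProd_eq le_rfl hu hu' (e.trans e'.symm)
  rwa [e, hv.eq]

theorem normalForm_wordProd (h : IsCosetChain cs top) (hu : IsNormal top n u) :
    normalForm cs (cs.wordProd u) = u := by
  refine normalForm_eq_of_least cs ⟨h.isReduced_of_isNormal hu, rfl⟩ fun v hv hne => ?_
  rcases h.normalWordsLeast le_rfl hu (fun a _ => a.isLt) hv.2.symm with _ | huv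
  · exact (hne rfl).elim
  · exact huv

theorem isNormal_normalForm (h : IsCosetChain cs top) (w : W) :
    IsNormal top n (normalForm cs w) := by
  obtain ⟨u, rfl⟩ := cs.wordProd_surjective w
  obtain ⟨v, hv, e, -⟩ := h.exists_isNormal le_rfl (u := u) fun a _ => a.isLt
  rwa [← e, h.normalForm_wordProd hv]

theorem length_lt_of_ne_longest (h : IsCosetChain cs top) {w : W} (hw : w ≠ longest cs top n) :
    cs.length w < cs.length (longest cs top n) := by
  have hlt := (h.isNormal_normalForm w).length_lt_of_ne h.toIsChainLength le_rfl fun e =>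
    hw (by rw [← wordProd_normalForm cs w, e, longest])
  rwa [← (h.isReduced_of_isNormal (h.isNormal_normalForm w)).eq, wordProd_normalForm,
    ← (h.isReduced_of_isNormal (isNormal_longestWord n)).eq] at hlt

theorem isLongest_iff (h : IsCosetChain cs top) {w : W} :
    IsLongest cs w ↔ w = longest cs top n := by
  constructor
  · intro hw
    by_contra hne
    exact (h.length_lt_of_ne_longest hne).not_ge (hw _)
  · rintro rfl v
    rcases eq_or_ne v (longest cs top n) with rfl | hv
    · exact le_rfl
    · exact (h.length_lt_of_ne_longest hv).le

theorem eq_of_longest_mul (h : IsCosetChain cs top) (hi : i < n) {p p' : List (Fin n)}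
    (hp : IsNormal top i p) (hp' : IsNormal top i p') (hk : k ≤ top (i + 1))
    (hl : l ≤ top (i + 1))
    (e : cs.wordProd (chainWord n top (i + 1) l ++ p') =
      longest cs top (i + 1) * cs.wordProd (chainWord n top (i + 1) k ++ p)) :
    l = top (i + 1) - k ∧ cs.wordProd p' = longest cs top i * cs.wordProd p := by
  have e' : chainRep cs top (i + 1) l * cs.wordProd p' =
      chainRep cs top (i + 1) (top (i + 1) - k) * (longest cs top i * cs.wordProd p) := by
    rw [← mul_assoc, ← h.reversal hi hk, mul_assoc, chainRep, chainRep, ← cs.wordProd_append,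
      ← cs.wordProd_append, e]
  obtain rfl := h.sep hi hl (Nat.sub_le _ _) (wordProd_mem_parabolic hp'.lt_of_mem)
    (mul_mem longest_mem_parabolic (wordProd_mem_parabolic hp.lt_of_mem)) e'
  exact ⟨rfl, mul_left_cancel e'⟩

theorem levelLT_of_longest_mul (h : IsCosetChain cs top) (hi : i ≤ n) {u' v' : List (Fin n)}
    (hu : IsNormal top i u) (hv : IsNormal top i v) (hu' : IsNormal top i u')
    (hv' : IsNormal top i v') (eu : cs.wordProd u' = longest cs top i * cs.wordProd u)
    (ev : cs.wordProd v' = longest cs top i * cs.wordProd v) (huv : levelLT i u v) :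
    levelLT i v' u' := by
  induction i generalizing u v u' v' with
  | zero => exact huv.elim
  | succ i ih =>
    obtain _ | @⟨_, k, p, hk, hp⟩ := hu
    obtain _ | @⟨_, l, q, hl, hq⟩ := hv
    obtain _ | @⟨_, k', p', hk', hp'⟩ := hu'
    obtain _ | @⟨_, l', q', hl', hq'⟩ := hv'
    obtain ⟨rfl, ep⟩ := h.eq_of_longest_mul hi hp hp' hk hk' eu
    obtain ⟨rfl, eq⟩ := h.eq_of_longest_mul hi hq hq' hl hl' ev
    have ht := h.toIsChainLength
    rw [levelLT_chainWord_append_iff ht hi hl' hk' hq'.lt_of_mem hp'.lt_of_mem]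
    rcases (levelLT_chainWord_append_iff ht hi hk hl hp.lt_of_mem hq.lt_of_mem).1 huv
      with hkl | ⟨rfl, hpq⟩
    · exact .inl (by omega)
    · exact .inr ⟨rfl, ih (Nat.le_of_succ_le hi) hp hq hp' hq' ep eq hpq⟩

theorem groupLT_longest_mul (h : IsCosetChain cs top) {v w : W} (hvw : groupLT cs v w) :
    groupLT cs (longest cs top n * w) (longest cs top n * v) :=
  h.levelLT_of_longest_mul le_rfl (h.isNormal_normalForm v) (h.isNormal_normalForm w)
    (h.isNormal_normalForm _) (h.isNormal_normalForm _) (by simp) (by simp) hvw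

theorem label_add_label [Finite W] (h : IsCosetChain cs top) (w : W) :
    label cs w + label cs (longest cs top n * w) = Nat.card W + 1 := by
  have hcount := ncard_add_ncard_of_reversing (r := groupLT cs) (Equiv.mulLeft (longest cs top n))
    (fun _ _ => h.groupLT_longest_mul) w
  simp only [Equiv.coe_mulLeft] at hcount
  rw [label, label]
  omega

end IsCosetChain

end CosetChains

section Involutions

variable {G : Type*} [Group G] {a b y : G}

theorem commute_iff_mul_pow_two (ha : a * a = 1) (hb : b * b = 1) :
    Commute a b ↔ (a * b) ^ 2 = 1 := by
  rw [commute_iff_eq, ← mul_inv_eq_one]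
  simp only [mul_inv_rev, inv_eq_of_mul_eq_one_left ha, inv_eq_of_mul_eq_one_left hb, pow_two]

theorem braid_iff_mul_pow_three (ha : a * a = 1) (hb : b * b = 1) :
    a * b * a = b * a * b ↔ (a * b) ^ 3 = 1 := by
  rw [← mul_inv_eq_one]
  simp only [mul_inv_rev, inv_eq_of_mul_eq_one_left ha, inv_eq_of_mul_eq_one_left hb, pow_succ,
    pow_zero, one_mul, mul_assoc]

theorem braid_iff_mul_pow_four (ha : a * a = 1) (hb : b * b = 1) :
    a * b * a * b = b * a * b * a ↔ (a * b) ^ 4 = 1 := by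
  rw [← mul_inv_eq_one]
  simp only [mul_inv_rev, inv_eq_of_mul_eq_one_left ha, inv_eq_of_mul_eq_one_left hb, pow_succ,
    pow_zero, one_mul, mul_assoc]

theorem semiconjBy_mul_of_braid (h : a * b * a = b * a * b) : SemiconjBy (a * b) a b := by
  rw [SemiconjBy, h, mul_assoc]

theorem commute_conj_of_braid (h : a * b * a = b * a * b) (hy : Commute b y) :
    Commute a (b * (a * y * a) * b) :=
  calc a * (b * (a * y * a) * b) = a * b * a * y * a * b := by simp only [mul_assoc]
    _ = b * a * (b * y) * a * b := by rw [h]; simp only [mul_assoc]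
    _ = b * a * y * (b * a * b) := by rw [hy.eq]; simp only [mul_assoc]
    _ = b * (a * y * a) * b * a := by rw [← h]; simp only [mul_assoc]

theorem isLiftable_of_lt {n : ℕ} {M : CoxeterMatrix (Fin n)} {f : Fin n → G}
    (hsq : ∀ a, f a * f a = 1) (h : ∀ a b, a < b → (f a * f b) ^ M a b = 1) :
    M.IsLiftable f := by
  intro a b
  rcases lt_trichotomy a b with hab | rfl | hba
  · exact h a b hab
  · rw [M.diagonal, pow_one, hsq]
  · have hinv : f a * f b = (f b * f a)⁻¹ := by
      rw [mul_inv_rev, inv_eq_of_mul_eq_one_left (hsq a), inv_eq_of_mul_eq_one_left (hsq b)]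
    rw [hinv, inv_pow, M.symmetric, h b a hba, inv_one]

end Involutions

section Separation

variable {n : ℕ} {M : CoxeterMatrix (Fin n)} {W : Type*} [Group W]
  {cs : CoxeterSystem M W} {top : ℕ → ℕ} {i k l : ℕ}

/-- A family of permutations of the integers under which the coset representative of length `k` on
`i` letters takes the point `i - 1` to `i - 1 - k`, so that the images of the point tell the cosets
apart. The field `turn` covers the second occurrence of the largest letter in a chain word. -/
structure IsDescent (top : ℕ → ℕ) (f : ℕ → Equiv.Perm ℤ) : Prop where
  fixed : ∀ {i j : ℕ}, j < i → f j i = i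
  down : ∀ i : ℕ, f i i = i - 1
  turn : ∀ {i : ℕ}, top (i + 1) = top i + 2 → f i (i - 1 - top i) = i - 2 - top i

theorem lift_gen {G : Type*} [Group G] {f : ℕ → G} (hf : M.IsLiftable fun a : Fin n => f a)
    (hi : i < n) : cs.lift ⟨_, hf⟩ (gen cs i) = f i := by
  rw [gen_of_lt cs hi, cs.lift_apply_simple]

variable {f : ℕ → Equiv.Perm ℤ} (hf : M.IsLiftable fun a : Fin n => f a)

theorem lift_chainRep_apply (ht : IsChainLength top) (h : IsDescent top f) (hi : i ≤ n)
    (hk : k ≤ top i) : cs.lift ⟨_, hf⟩ (chainRep cs top i k) (i - 1) = i - 1 - k := by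
  induction i generalizing k with
  | zero =>
    rw [ht.zero, Nat.le_zero] at hk
    simp [hk]
  | succ i ih =>
    have hdown : cs.lift ⟨_, hf⟩ (gen cs i) ((i + 1 : ℕ) - 1) = i - 1 := by
      rw [lift_gen hf hi, Nat.cast_succ, add_sub_cancel_right, h.down]
    rcases k with _ | k
    · simp
    rcases le_or_gt k (top i) with hki | hki
    · rw [chainRep_succ hki, map_mul, Equiv.Perm.mul_apply, hdown, ih (Nat.le_of_succ_le hi) hki]
      push_cast
      ring
    · obtain ⟨rfl, htop⟩ : k = top i + 1 ∧ top (i + 1) = top i + 2 := by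
        have := ht.succ i
        omega
      rw [chainRep_succ_of_lt hki, map_mul, map_mul, Equiv.Perm.mul_apply, Equiv.Perm.mul_apply,
        hdown, ih (Nat.le_of_succ_le hi) le_rfl, lift_gen hf hi, h.turn htop]
      push_cast
      ring

theorem lift_apply_of_mem_parabolic (h : IsDescent top f) (hi : i < n) {x : W}
    (hx : x ∈ parabolic cs i) : cs.lift ⟨_, hf⟩ x i = i := by
  have hle : parabolic cs i ≤
      (MulAction.stabilizer (Equiv.Perm ℤ) (i : ℤ)).comap (cs.lift ⟨_, hf⟩) := by
    rw [parabolic, Subgroup.closure_le]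
    rintro _ ⟨j, hj, rfl⟩
    change cs.lift ⟨_, hf⟩ (gen cs j) i = i
    rw [lift_gen hf (lt_trans hj hi), h.fixed hj]
  exact hle hx

include hf in
theorem eq_of_chainRep_mul_eq (ht : IsChainLength top) (h : IsDescent top f) {x y : W} (hi : i < n)
    (hk : k ≤ top (i + 1)) (hl : l ≤ top (i + 1)) (hx : x ∈ parabolic cs i)
    (hy : y ∈ parabolic cs i)
    (e : chainRep cs top (i + 1) k * x = chainRep cs top (i + 1) l * y) : k = l := by
  have hval {k : ℕ} (hk : k ≤ top (i + 1)) {x : W} (hx : x ∈ parabolic cs i) :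
      cs.lift ⟨_, hf⟩ (chainRep cs top (i + 1) k * x) i = i - k := by
    have := lift_chainRep_apply (cs := cs) hf ht h hi hk
    rwa [Nat.cast_succ, add_sub_cancel_right, ← lift_apply_of_mem_parabolic hf h hi hx,
      ← Equiv.Perm.mul_apply, ← map_mul, lift_apply_of_mem_parabolic hf h hi hx] at this
  have := hval hk hx
  rw [e, hval hl hy] at this
  omega

end Separation

section Steps

variable {n : ℕ} {M : CoxeterMatrix (Fin n)} {W : Type*} [Group W]
  {cs : CoxeterSystem M W} {top : ℕ → ℕ} {i j k : ℕ}

theorem commute_gen (hM : ∀ a b : Fin n, (a : ℕ) + 1 < b → M a b = 2) (hj : j + 1 < i) :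
    Commute (gen cs j) (gen cs i) := by
  rcases lt_or_ge i n with hi | hi
  · rw [commute_iff_mul_pow_two (gen_mul_self cs j) (gen_mul_self cs i),
      gen_of_lt cs (by omega : j < n), gen_of_lt cs hi, ← hM ⟨j, by omega⟩ ⟨i, hi⟩ hj,
      cs.simple_mul_simple_pow]
  · rw [gen_of_le cs hi]
    exact .one_right _

theorem gen_braid (hi : i + 1 < n) (hM : M ⟨i, Nat.lt_of_succ_lt hi⟩ ⟨i + 1, hi⟩ = 3) :
    gen cs i * gen cs (i + 1) * gen cs i = gen cs (i + 1) * gen cs i * gen cs (i + 1) := by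
  rw [braid_iff_mul_pow_three (gen_mul_self cs _) (gen_mul_self cs _), gen_of_lt cs hi,
    gen_of_lt cs (Nat.lt_of_succ_lt hi), ← hM, cs.simple_mul_simple_pow]

theorem commute_chainRep {w : W} (hw : ∀ j < i, Commute (gen cs j) w) :
    Commute (chainRep cs top i k) w :=
  commute_of_mem_parabolic chainRep_mem_parabolic hw

theorem isStep_zero (ht : IsChainLength top) (hj : j ≤ i) : IsStep cs top (i + 1) j 0 := by
  rcases hj.eq_or_lt with rfl | hj
  · refine .inl ⟨1, ?_, le_rfl, ?_⟩
    · have := ht.succ j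
      omega
    · rw [chainRep_succ (Nat.zero_le _), chainRep_zero_right, chainRep_zero_right, mul_one,
        one_mul]
  · exact .inr ⟨j, hj, by simp⟩

theorem isStep_succ (ht : IsChainLength top) (hcomm : ∀ j < i - 1, Commute (gen cs j) (gen cs i))
    (hk : k ≤ top i) (h : IsStep cs top i j k) : IsStep cs top (i + 1) j (k + 1) := by
  rw [IsStep, chainRep_succ hk, ← mul_assoc]
  rcases h with ⟨k', hk', hkk', e⟩ | ⟨j', hj', e⟩
  · refine .inl ⟨k' + 1, ?_, Nat.succ_le_succ hkk', ?_⟩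
    · have := ht.succ i
      omega
    · rw [e, chainRep_succ hk']
  · refine .inr ⟨j', by omega, ?_⟩
    rw [e, mul_assoc, (hcomm j' hj').eq, mul_assoc]

theorem isStep_one : IsStep cs top (i + 1) i 1 := by
  refine .inl ⟨0, Nat.zero_le _, Nat.zero_le _, ?_⟩
  rw [chainRep_succ (Nat.zero_le _), chainRep_zero_right, chainRep_zero_right, one_mul,
    gen_mul_self]

theorem isStep_turn (htop : top (i + 1) = top i + 2) : IsStep cs top (i + 1) i (top i + 1) := by
  refine .inl ⟨top i + 2, htop.ge, le_rfl, ?_⟩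
  rw [chainRep_succ le_rfl, chainRep_succ_of_lt (Nat.lt_succ_self _), mul_assoc]

theorem isStep_braid (hcomm : ∀ j < i, Commute (gen cs j) (gen cs (i + 1)))
    (hbraid : gen cs i * gen cs (i + 1) * gen cs i = gen cs (i + 1) * gen cs i * gen cs (i + 1))
    (hk : k ≤ top i) (hk' : k + 1 ≤ top (i + 1)) : IsStep cs top (i + 2) (i + 1) (k + 2) := by
  refine .inr ⟨i, Nat.lt_succ_self i, ?_⟩
  have hc : Commute (chainRep cs top i k) (gen cs (i + 1)) := commute_chainRep hcomm
  rw [chainRep_succ hk', chainRep_succ hk]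
  calc gen cs (i + 1) * (chainRep cs top i k * gen cs i * gen cs (i + 1))
      = chainRep cs top i k * (gen cs (i + 1) * gen cs i * gen cs (i + 1)) := by
        simp only [← mul_assoc, hc.eq]
    _ = chainRep cs top i k * gen cs i * gen cs (i + 1) * gen cs i := by
        rw [← hbraid]; simp only [mul_assoc]

theorem isStep_of_braid (ht : IsChainLength top)
    (hcomm : ∀ {i j : ℕ}, j + 1 < i → Commute (gen cs j) (gen cs i))
    (hbraid : ∀ {i k : ℕ}, i + 1 < n → k < top (i + 1) →
      k + 1 = top (i + 1) ∧ top (i + 2) = top (i + 1) + 2 ∨ k ≤ top i ∧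
        gen cs i * gen cs (i + 1) * gen cs i = gen cs (i + 1) * gen cs i * gen cs (i + 1))
    (hturn : ∀ {i j : ℕ}, i < n → top (i + 1) = top i + 2 → j < i →
      Commute (gen cs j) (chainRep cs top (i + 1) (top (i + 1))))
    (hi : i ≤ n) (hj : j < i) (hk : k ≤ top i) : IsStep cs top i j k := by
  induction i generalizing j k with
  | zero => exact (Nat.not_lt_zero _ hj).elim
  | succ i ih =>
    rcases k with _ | k
    · exact isStep_zero ht (Nat.le_of_lt_succ hj)
    rcases le_or_gt k (top i) with hki | hki
    · rcases (Nat.le_of_lt_succ hj).eq_or_lt with rfl | hji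
      · rcases k with _ | k
        · exact isStep_one
        obtain ⟨j, rfl⟩ : ∃ j', j = j' + 1 := Nat.exists_eq_add_one_of_ne_zero (by
          rintro rfl
          rw [ht.zero] at hki
          omega)
        rcases hbraid hi hki with ⟨hk', htop⟩ | ⟨hk', hb⟩
        · exact hk' ▸ isStep_turn htop
        · exact isStep_braid (fun l hl => hcomm (Nat.succ_lt_succ hl)) hb hk' hki
      · exact isStep_succ ht (fun l hl => hcomm (by omega)) hki (ih (Nat.le_of_succ_le hi) hji hki)
    · obtain ⟨rfl, htop⟩ : k = top i + 1 ∧ top (i + 1) = top i + 2 := by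
        have := ht.succ i
        omega
      rcases (Nat.le_of_lt_succ hj).eq_or_lt with rfl | hji
      · refine .inl ⟨top j + 1, by omega, by omega, ?_⟩
        rw [chainRep_succ_of_lt hki, chainRep_succ le_rfl, mul_assoc, ← mul_assoc, gen_mul_self,
          one_mul]
      · exact .inr ⟨j, hji, htop ▸ (hturn hi htop hji).eq⟩

theorem longest_succ_mul_chainRep_succ (hcomm : ∀ j < i - 1, Commute (gen cs j) (gen cs i))
    (hk : k ≤ top i)
    (hrev : longest cs top i * chainRep cs top i k =
      chainRep cs top i (top i - k) * longest cs top (i - 1)) :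
    longest cs top (i + 1) * chainRep cs top (i + 1) (k + 1) =
      chainRep cs top (i + 1) (top (i + 1)) * chainRep cs top i (top i - k) * gen cs i *
        longest cs top (i - 1) := by
  have hc : Commute (longest cs top (i - 1)) (gen cs i) :=
    commute_of_mem_parabolic longest_mem_parabolic hcomm
  rw [longest_succ, chainRep_succ hk, mul_assoc, ← mul_assoc (longest cs top i), hrev]
  simp only [mul_assoc, hc.eq]

end Steps

section TypeA

variable {n : ℕ}

theorem typeA_apply_of_lt (a b : Fin n) (h : (a : ℕ) + 1 < b) : CoxeterMatrix.A n a b = 2 := by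
  have : CoxeterMatrix.A n a b = if a = b then 1
      else if (b : ℕ) + 1 = a ∨ (a : ℕ) + 1 = b then 3 else 2 := rfl
  rw [this, if_neg (by rintro rfl; omega), if_neg (by omega)]

theorem typeA_apply_of_succ (a b : Fin n) (h : (a : ℕ) + 1 = b) : CoxeterMatrix.A n a b = 3 := by
  have : CoxeterMatrix.A n a b = if a = b then 1
      else if (b : ℕ) + 1 = a ∨ (a : ℕ) + 1 = b then 3 else 2 := rfl
  rw [this, if_neg (by rintro rfl; omega), if_pos (by omega)]

theorem isChainLength_id : IsChainLength id := ⟨rfl, fun _ => .inl rfl⟩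

/-- The adjacent transpositions, through which the Coxeter group of type `A` acts on the
integers. -/
def adjacentSwap (j : ℕ) : Equiv.Perm ℤ := Equiv.swap (j - 1) j

theorem adjacentSwap_apply (j : ℕ) (x : ℤ) :
    adjacentSwap j x = if x = j - 1 then (j : ℤ) else if x = j then j - 1 else x :=
  Equiv.swap_apply_def _ _ _

theorem adjacentSwap_mul_self (j : ℕ) : adjacentSwap j * adjacentSwap j = 1 :=
  Equiv.swap_mul_self _ _

theorem isLiftable_adjacentSwap :
    (CoxeterMatrix.A n).IsLiftable fun a : Fin n => adjacentSwap a := by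
  refine isLiftable_of_lt (fun a => adjacentSwap_mul_self a) fun a b hab => ?_
  rcases (Nat.succ_le_of_lt hab).eq_or_lt with h | h
  · rw [typeA_apply_of_succ a b h,
      ← braid_iff_mul_pow_three (adjacentSwap_mul_self a) (adjacentSwap_mul_self b)]
    ext x
    grind [adjacentSwap_apply, Equiv.Perm.mul_apply]
  · rw [typeA_apply_of_lt a b h,
      ← commute_iff_mul_pow_two (adjacentSwap_mul_self a) (adjacentSwap_mul_self b)]
    ext x
    grind [adjacentSwap_apply, Equiv.Perm.mul_apply]

theorem isDescent_adjacentSwap : IsDescent id adjacentSwap where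
  fixed hj := Equiv.swap_apply_of_ne_of_ne (by omega) (by omega)
  down i := Equiv.swap_apply_right _ _
  turn h := by simp at h

variable {W : Type*} [Group W] {cs : CoxeterSystem (CoxeterMatrix.A n) W} {i j k : ℕ}

theorem gen_braid_typeA (hi : i + 1 < n) :
    gen cs i * gen cs (i + 1) * gen cs i = gen cs (i + 1) * gen cs i * gen cs (i + 1) :=
  gen_braid hi (typeA_apply_of_succ _ _ rfl)

theorem chainRep_id_self_succ (i : ℕ) :
    chainRep cs id (i + 1) (i + 1) = chainRep cs id i i * gen cs i :=
  chainRep_succ (top := id) le_rfl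

theorem semiconjBy_chainRep_self (hi : i ≤ n) (hj : j + 1 < i) :
    SemiconjBy (chainRep cs id i i) (gen cs j) (gen cs (j + 1)) := by
  induction i with
  | zero => exact (Nat.not_lt_zero _ hj).elim
  | succ i ih =>
    rw [chainRep_id_self_succ]
    rcases (Nat.le_of_lt_succ hj).eq_or_lt with rfl | hji
    · have hc : Commute (chainRep cs id j j) (gen cs (j + 1)) :=
        commute_chainRep fun l hl => commute_gen typeA_apply_of_lt (Nat.succ_lt_succ hl)
      rw [chainRep_id_self_succ, mul_assoc]
      exact SemiconjBy.mul_left hc (semiconjBy_mul_of_braid (gen_braid_typeA hi))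
    · exact (ih (Nat.le_of_succ_le hi) hji).mul_left (commute_gen typeA_apply_of_lt hji).symm

theorem semiconjBy_chainRep {w : W} (hw : ∀ j < i, SemiconjBy w (gen cs j) (gen cs (j + 1)))
    (hk : k ≤ i) : SemiconjBy w (chainRep cs id i k) (chainRep cs id (i + 1) k) := by
  induction i generalizing k with
  | zero =>
    obtain rfl := Nat.le_zero.1 hk
    simp
  | succ i ih =>
    rcases k with _ | k
    · simp
    have hk' : k ≤ i := Nat.le_of_succ_le_succ hk
    rw [chainRep_succ (top := id) hk', chainRep_succ (top := id) (Nat.le_succ_of_le hk')]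
    exact (ih (fun j hj => hw j (Nat.lt_succ_of_lt hj)) hk').mul_right (hw i (Nat.lt_succ_self i))

theorem reversal_typeA (hi : i ≤ n) (hk : k ≤ i) : longest cs id i * chainRep cs id i k =
    chainRep cs id i (i - k) * longest cs id (i - 1) := by
  induction i generalizing k with
  | zero =>
    obtain rfl := Nat.le_zero.1 hk
    simp
  | succ i ih =>
    rcases k with _ | k
    · simp [longest_succ]
    have hk' : k ≤ i := Nat.le_of_succ_le_succ hk
    have hshift : SemiconjBy (chainRep cs id (i + 1) (i + 1)) (chainRep cs id i (i - k))
        (chainRep cs id (i + 1) (i - k)) :=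
      semiconjBy_chainRep (fun j hj => semiconjBy_chainRep_self hi (Nat.succ_lt_succ hj))
        (Nat.sub_le i k)
    calc longest cs id (i + 1) * chainRep cs id (i + 1) (k + 1)
        = chainRep cs id (i + 1) (i + 1) * chainRep cs id i (i - k) * gen cs i *
            longest cs id (i - 1) :=
          longest_succ_mul_chainRep_succ (fun j hj => commute_gen typeA_apply_of_lt (by omega)) hk'
            (ih (Nat.le_of_succ_le hi) hk')
      _ = chainRep cs id (i + 1) (i - k) * (chainRep cs id i i * gen cs i) * gen cs i *
            longest cs id (i - 1) := by rw [hshift.eq, chainRep_id_self_succ]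
      _ = chainRep cs id (i + 1) (i - k) * (chainRep cs id i i * longest cs id (i - 1)) := by
          simp only [mul_assoc, gen_mul_self_assoc]
      _ = chainRep cs id (i + 1) (i + 1 - (k + 1)) * longest cs id i := by
          rw [Nat.add_sub_add_right, longest_eq i, id]

theorem isCosetChain_typeA (cs : CoxeterSystem (CoxeterMatrix.A n) W) : IsCosetChain cs id where
  toIsChainLength := isChainLength_id
  comm := commute_gen typeA_apply_of_lt
  step hi hj hk := isStep_of_braid isChainLength_id (commute_gen typeA_apply_of_lt)
    (fun hi hk => .inr ⟨Nat.le_of_lt_succ hk, gen_braid_typeA hi⟩) (fun _ h => by simp at h) hi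
    (Nat.lt_succ_of_le hj) hk
  sep := eq_of_chainRep_mul_eq isLiftable_adjacentSwap isChainLength_id isDescent_adjacentSwap
  reversal := reversal_typeA

end TypeA

section TypeB

variable {n : ℕ}

theorem typeB_apply (a b : Fin n) : typeB n a b =
    if a = b then 1
    else if (a : ℕ) = 0 ∧ (b : ℕ) = 1 ∨ (b : ℕ) = 0 ∧ (a : ℕ) = 1 then 4
    else if (b : ℕ) + 1 = a ∨ (a : ℕ) + 1 = b then 3 else 2 := by
  have hrev : typeB n a b = if a.rev = b.rev then 1
      else if (a.rev : ℕ) = n - 1 ∧ (b.rev : ℕ) = n - 2 ∨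
        (b.rev : ℕ) = n - 1 ∧ (a.rev : ℕ) = n - 2 then 4
      else if (b.rev : ℕ) + 1 = a.rev ∨ (a.rev : ℕ) + 1 = b.rev then 3 else 2 := rfl
  rw [hrev]
  simp only [Fin.ext_iff, Fin.val_rev]
  split_ifs <;> omega

theorem typeB_apply_of_lt (a b : Fin n) (h : (a : ℕ) + 1 < b) : typeB n a b = 2 := by
  rw [typeB_apply, if_neg (by rintro rfl; omega), if_neg (by omega), if_neg (by omega)]

theorem typeB_apply_of_succ (a b : Fin n) (ha : (a : ℕ) ≠ 0) (h : (a : ℕ) + 1 = b) :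
    typeB n a b = 3 := by
  rw [typeB_apply, if_neg (by rintro rfl; omega), if_neg (by omega), if_pos (by omega)]

theorem typeB_apply_of_zero (a b : Fin n) (ha : (a : ℕ) = 0) (hb : (b : ℕ) = 1) :
    typeB n a b = 4 := by
  rw [typeB_apply, if_neg (by rintro rfl; omega), if_pos (by omega)]

/-- The chain lengths in type `B`. -/
def topB (i : ℕ) : ℕ := 2 * i - 1

theorem isChainLength_topB : IsChainLength topB := ⟨rfl, fun i => by simp only [topB]; omega⟩

theorem topB_add_two (i : ℕ) : topB (i + 2) = topB (i + 1) + 2 := rfl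

/-- The permutations through which the Coxeter group of type `B` acts on the integers. They commute
with `x ↦ -1 - x`, so these are the usual signed permutations of the points `x + 1 / 2`. -/
def signedSwap (j : ℕ) : Equiv.Perm ℤ :=
  Function.Involutive.toPerm
    (fun x => if x = j ∨ x = -j then x - 1 else if x = j - 1 ∨ x = -j - 1 then x + 1 else x)
    fun x => by grind

theorem signedSwap_apply (j : ℕ) (x : ℤ) : signedSwap j x =
    if x = j ∨ x = -j then x - 1 else if x = j - 1 ∨ x = -j - 1 then x + 1 else x := rfl

theorem signedSwap_mul_self (j : ℕ) : signedSwap j * signedSwap j = 1 :=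
  Equiv.ext (signedSwap j).left_inv

theorem isLiftable_signedSwap : (typeB n).IsLiftable fun a : Fin n => signedSwap a := by
  refine isLiftable_of_lt (fun a => signedSwap_mul_self a) fun a b hab => ?_
  rcases (Nat.succ_le_of_lt hab).eq_or_lt with h | h
  · rcases eq_or_ne (a : ℕ) 0 with ha | ha
    · rw [typeB_apply_of_zero a b ha (by omega),
        ← braid_iff_mul_pow_four (signedSwap_mul_self a) (signedSwap_mul_self b), ← h, ha]
      ext x
      grind (splits := 30) [signedSwap_apply, Equiv.Perm.mul_apply]
    · rw [typeB_apply_of_succ a b ha h,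
        ← braid_iff_mul_pow_three (signedSwap_mul_self a) (signedSwap_mul_self b), ← h]
      ext x
      grind (splits := 20) [signedSwap_apply, Equiv.Perm.mul_apply]
  · rw [typeB_apply_of_lt a b h,
      ← commute_iff_mul_pow_two (signedSwap_mul_self a) (signedSwap_mul_self b)]
    ext x
    grind [signedSwap_apply, Equiv.Perm.mul_apply]

theorem isDescent_signedSwap : IsDescent topB signedSwap where
  fixed hj := by grind [signedSwap_apply]
  down i := by grind [signedSwap_apply]
  turn h := by grind [signedSwap_apply, topB]

variable {W : Type*} [Group W] {cs : CoxeterSystem (typeB n) W} {i j k : ℕ}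

theorem gen_braid_typeB (hi : i + 1 < n) (hi0 : i ≠ 0) :
    gen cs i * gen cs (i + 1) * gen cs i = gen cs (i + 1) * gen cs i * gen cs (i + 1) :=
  gen_braid hi (typeB_apply_of_succ _ _ hi0 rfl)

theorem gen_braid_typeB_zero (hn : 1 < n) :
    gen cs 0 * gen cs 1 * gen cs 0 * gen cs 1 = gen cs 1 * gen cs 0 * gen cs 1 * gen cs 0 := by
  rw [braid_iff_mul_pow_four (gen_mul_self cs 0) (gen_mul_self cs 1), gen_of_lt cs hn,
    gen_of_lt cs (Nat.zero_lt_of_lt hn),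
    ← typeB_apply_of_zero ⟨0, Nat.zero_lt_of_lt hn⟩ ⟨1, hn⟩ rfl rfl, cs.simple_mul_simple_pow]

theorem chainRep_topB_one : chainRep cs topB 1 (topB 1) = gen cs 0 := by
  rw [show topB 1 = 0 + 1 from rfl, chainRep_succ (Nat.zero_le _), chainRep_zero_right, one_mul]

theorem chainRep_topB_add_two (i : ℕ) : chainRep cs topB (i + 2) (topB (i + 2)) =
    gen cs (i + 1) * chainRep cs topB (i + 1) (topB (i + 1)) * gen cs (i + 1) := by
  rw [topB_add_two, chainRep_succ_of_lt (Nat.lt_succ_self _)]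

theorem chainRep_topB_mul_self (i : ℕ) :
    chainRep cs topB i (topB i) * chainRep cs topB i (topB i) = 1 := by
  induction i using Nat.twoStepInduction with
  | zero => simp [topB]
  | one => rw [chainRep_topB_one, gen_mul_self]
  | more i _ ih =>
    rw [chainRep_topB_add_two]
    simp only [mul_assoc, gen_mul_self_assoc]
    rw [← mul_assoc (chainRep _ _ _ _), ih, one_mul, gen_mul_self]

theorem commute_gen_chainRep_topB (hi : i < n) (hj : j < i) :
    Commute (gen cs j) (chainRep cs topB (i + 1) (topB (i + 1))) := by
  induction i with
  | zero => exact (Nat.not_lt_zero _ hj).elim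
  | succ i ih =>
    rw [chainRep_topB_add_two]
    rcases (Nat.le_of_lt_succ hj).eq_or_lt with rfl | hji
    · rcases j with _ | j
      · rw [chainRep_topB_one, commute_iff_eq]
        simpa only [mul_assoc] using gen_braid_typeB_zero hi
      · rw [chainRep_topB_add_two]
        exact commute_conj_of_braid (gen_braid_typeB hi j.succ_ne_zero)
          (commute_chainRep fun l hl => commute_gen typeB_apply_of_lt (Nat.succ_lt_succ hl)).symm
    · have hc : Commute (gen cs j) (gen cs (i + 1)) :=
        commute_gen typeB_apply_of_lt (Nat.succ_lt_succ hji)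
      exact (hc.mul_right (ih (Nat.lt_of_succ_lt hi) hji)).mul_right hc

theorem commute_chainRep_topB (hi : i < n) {x : W} (hx : x ∈ parabolic cs i) :
    Commute x (chainRep cs topB (i + 1) (topB (i + 1))) :=
  commute_of_mem_parabolic hx fun _ hj => commute_gen_chainRep_topB hi hj

theorem longest_mul_chainRep_topB (hi : i < n) :
    longest cs topB (i + 1) * chainRep cs topB (i + 1) (topB (i + 1)) = longest cs topB i := by
  rw [longest_succ, mul_assoc, (commute_chainRep_topB hi longest_mem_parabolic).eq, ← mul_assoc,
    chainRep_topB_mul_self, one_mul]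

theorem reversal_typeB (hi : i ≤ n) (hk : k ≤ topB i) :
    longest cs topB i * chainRep cs topB i k =
      chainRep cs topB i (topB i - k) * longest cs topB (i - 1) := by
  induction i generalizing k with
  | zero =>
    obtain rfl : k = 0 := Nat.le_zero.1 hk
    simp [topB]
  | succ i ih =>
    rcases k with _ | k
    · simp [longest_succ]
    rcases hk.eq_or_lt with hk' | hk'
    · rw [hk', Nat.sub_self, chainRep_zero_right, one_mul, longest_mul_chainRep_topB hi,
        Nat.add_sub_cancel]
    obtain ⟨i, rfl⟩ : ∃ i', i = i' + 1 := Nat.exists_eq_add_one_of_ne_zero (by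
      rintro rfl
      simp [topB] at hk')
    have hki : k ≤ topB (i + 1) := by
      rw [topB_add_two] at hk'
      omega
    have hsub : topB (i + 2) - (k + 1) = topB (i + 1) - k + 1 := by
      rw [topB_add_two]
      omega
    calc longest cs topB (i + 2) * chainRep cs topB (i + 2) (k + 1)
        = chainRep cs topB (i + 2) (topB (i + 2)) * chainRep cs topB (i + 1) (topB (i + 1) - k) *
            gen cs (i + 1) * longest cs topB i :=
          longest_succ_mul_chainRep_succ (fun j hj => commute_gen typeB_apply_of_lt (by omega)) hki
            (ih (Nat.le_of_succ_le hi) hki)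
      _ = chainRep cs topB (i + 1) (topB (i + 1) - k) *
            (gen cs (i + 1) * chainRep cs topB (i + 1) (topB (i + 1)) * gen cs (i + 1)) *
            gen cs (i + 1) * longest cs topB i := by
          rw [← (commute_chainRep_topB hi chainRep_mem_parabolic).eq, chainRep_topB_add_two]
      _ = chainRep cs topB (i + 1) (topB (i + 1) - k) * gen cs (i + 1) *
            (chainRep cs topB (i + 1) (topB (i + 1)) * longest cs topB i) := by
          simp only [mul_assoc, gen_mul_self_assoc]
      _ = chainRep cs topB (i + 2) (topB (i + 2) - (k + 1)) * longest cs topB (i + 1) := by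
          rw [hsub, chainRep_succ (Nat.sub_le _ _), longest_succ]

theorem isStep_typeB (hi : i ≤ n) (hj : j < i) (hk : k ≤ topB i) : IsStep cs topB i j k := by
  refine isStep_of_braid isChainLength_topB (commute_gen typeB_apply_of_lt) (fun {i k} hi hk => ?_)
    (fun hi _ hj => commute_gen_chainRep_topB hi hj) hi hj hk
  rcases Nat.lt_or_ge k (2 * i) with hki | hki
  · exact .inr ⟨by simp only [topB]; omega, gen_braid_typeB hi (by omega)⟩
  · exact .inl ⟨by simp only [topB] at hk ⊢; omega, topB_add_two i⟩

theorem isCosetChain_typeB (cs : CoxeterSystem (typeB n) W) : IsCosetChain cs topB where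
  toIsChainLength := isChainLength_topB
  comm := commute_gen typeB_apply_of_lt
  step hi hj hk := isStep_typeB hi (Nat.lt_succ_of_le hj) hk
  sep := eq_of_chainRep_mul_eq isLiftable_signedSwap isChainLength_topB isDescent_signedSwap
  reversal := reversal_typeB

end TypeB

end DeletionOrder

theorem theorem7p1 (n : ℕ) (M : CoxeterMatrix (Fin n))
    (hM : M = CoxeterMatrix.A n ∨ M = DeletionOrder.typeB n)
    {W : Type*} [Group W] (cs : CoxeterSystem M W) :
    Finite W ∧ (∃! ω₀ : W, DeletionOrder.IsLongest cs ω₀) ∧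
      ∀ ω₀ : W, DeletionOrder.IsLongest cs ω₀ → ∀ w : W,
        DeletionOrder.label cs w + DeletionOrder.label cs (ω₀ * w) = Nat.card W + 1 := by
  obtain ⟨top, h⟩ : ∃ top, DeletionOrder.IsCosetChain cs top := by
    rcases hM with rfl | rfl
    · exact ⟨id, DeletionOrder.isCosetChain_typeA cs⟩
    · exact ⟨DeletionOrder.topB, DeletionOrder.isCosetChain_typeB cs⟩
  have hlongest : DeletionOrder.IsLongest cs (DeletionOrder.longest cs top n) :=
    h.isLongest_iff.2 rfl
  have : Finite W := DeletionOrder.finite_of_isLongest cs hlongest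
  refine ⟨this, ⟨_, hlongest, fun _ => h.isLongest_iff.1⟩, fun ω₀ hω₀ w => ?_⟩
  rw [h.isLongest_iff.1 hω₀]
  exact h.label_add_label w
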